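/- Let $Y, Y_1, Y_2, \ldots$ be i.i.d. real random variables with distribution function $F$ and $E\,Y^2 < \infty$, and let $\tau \in (0,1)$. For $x, y \in \mathbb{R}$ put $$S_\tau(x,y) = \tfrac{\tau}{2}\big[((y-x)^+)^2 - (y^+)^2\big] + \tfrac{1-\tau}{2}\big[((y-x)^-)^2 - (y^-)^2\big],$$ $$I_\tau(x,y) = \tau (y-x)\,1_{\{y \ge x\}} - (1-\tau)(x-y)\,1_{\{y<x\}}.$$ Then the $\tau$-expectile $\mu_\tau = \operatorname{argmin}_{x\in\mathbb{R}} E\,S_\tau(x,Y)$ and, for every $n \ge 1$ and every realization of the sample, the empirical $\tau$-expectile $\hat\mu_{\tau,n} = \operatorname{argmin}_{x\in\mathbb{R}} \frac1n\sum_{k=1}^n S_\tau(x,Y_k)$ exist and are unique. With no continuity assumption on $F$, $$\sqrt{n}\,\big(\hat\mu_{\tau,n} - \mu_\tau\big) \xrightarrow{\ \mathcal{L}\ } \sigma_1 W\, 1_{\{W>0\}} + \sigma_2 W\, 1_{\{W<0\}},$$ where $W \sim N\big(0, E[I_\tau(\mu_\tau,Y)^2]\big)$, $$\sigma_1 = \frac{1}{\tau(1-F(\mu_\tau))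 + (1-\tau)F(\mu_\tau)}, \qquad \sigma_2 = \frac{1}{\tau(1-F(\mu_\tau-)) + (1-\tau)F(\mu_\tau-)},$$ and $F(x-) = P(Y<x)$ is the left limit of $F$ at $x$. Moreover, if $\operatorname{Var} Y > 0$, $P(Y = \mu_\tau) > 0$ and $\tau \ne 1/2$, then the limit law is not a normal distribution (degenerate normal distributions included). -/

import Mathlib

open MeasureTheory ProbabilityTheory Filter Set
open scoped ENNReal NNReal Topology

noncomputable section

namespace Expectile

/-- The asymmetric quadratic score
`S_τ(x, y) = τ/2 [((y - x)⁺)² - (y⁺)²] + (1 - τ)/2 [((y - x)⁻)² - (y⁻)²]`. -/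
def score (τ x y : ℝ) : ℝ :=
  τ / 2 * ((y - x)⁺ ^ 2 - y⁺ ^ 2) + (1 - τ) / 2 * ((y - x)⁻ ^ 2 - y⁻ ^ 2)

/-- The identification function
`I_τ(x, y) = τ (y - x) 1{y ≥ x} - (1 - τ) (x - y) 1{y < x}`. -/
def ident (τ x y : ℝ) : ℝ :=
  τ * (y - x) * (if x ≤ y then 1 else 0) - (1 - τ) * (x - y) * (if y < x then 1 else 0)

/-- `m` minimizes `x ↦ ∫ S_τ(x, y) dν(y)` over `ℝ`. -/
def IsExpectile (τ : ℝ) (ν : Measure ℝ) (m : ℝ) : Prop :=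
  ∀ x : ℝ, ∫ y, score τ m y ∂ν ≤ ∫ y, score τ x y ∂ν

/-- The `τ`-expectile `argmin_x ∫ S_τ(x, y) dν(y)` of a distribution `ν` on `ℝ`.
It is an arbitrary real number if there is no minimizer. -/
def expectile (τ : ℝ) (ν : Measure ℝ) : ℝ :=
  Classical.epsilon (IsExpectile τ ν)

/-- The empirical distribution `(1/n) ∑_{k < n} δ_{y k}` of the first `n` terms of a sequence
(the zero measure for `n = 0`). -/
def empiricalMeasure (n : ℕ) (y : ℕ → ℝ) : Measure ℝ :=
  (n : ℝ≥0∞)⁻¹ • ∑ k ∈ Finset.range n, Measure.dirac (y k)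

/-- The empirical `τ`-expectile of the first `n` terms of a sequence. -/
def sampleExpectile (τ : ℝ) (n : ℕ) (y : ℕ → ℝ) : ℝ :=
  expectile τ (empiricalMeasure n y)

/-- `σ₁ = 1 / (τ (1 - F(x)) + (1 - τ) F(x))` at the point `x`, with `F` the distribution
function of `ν`. -/
def sigmaOne (τ : ℝ) (ν : Measure ℝ) (x : ℝ) : ℝ :=
  1 / (τ * (1 - cdf ν x) + (1 - τ) * cdf ν x)

/-- `σ₂ = 1 / (τ (1 - F(x-)) + (1 - τ) F(x-))` at the point `x`, with `F(x-) = ν(-∞, x)` the left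
limit at `x` of the distribution function of `ν`. -/
def sigmaTwo (τ : ℝ) (ν : Measure ℝ) (x : ℝ) : ℝ :=
  1 / (τ * (1 - ν.real (Iio x)) + (1 - τ) * ν.real (Iio x))

/-- `w ↦ σ₁ w 1{w > 0} + σ₂ w 1{w < 0}`. -/
def twoSlope (σ₁ σ₂ w : ℝ) : ℝ :=
  σ₁ * w * (if 0 < w then 1 else 0) + σ₂ * w * (if w < 0 then 1 else 0)

end Expectile

end

/-!
Write `λ(x) = ∫ I_τ(x, y) dν(y)` for the expected identification function (`meanIdent`). Pointwise,
`x ↦ S_τ(x, y)` is strongly convex with derivative `-I_τ(x, y)` (`le_score_sub`), and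
`x ↦ I_τ(x, y)` decreases with slopes between `min τ (1 - τ)` and `1`. Hence, for every
distribution `ν` with finite mean, `λ` is continuous and strictly decreasing with exactly one zero,
and this zero is the unique minimizer of the expected score
(`isExpectile_iff_of_meanIdent_eq_zero`). Applied to the law of `Y` and to the empirical
distributions, this gives the existence and uniqueness claims.

For the limit law, let `λₙ` be the function `λ` of the empirical distribution, `μ̂` the sample
expectile and `m` the expectile. For `x > m`, the difference `λₙ(m) - λₙ(x)` is `x - m` times
`τ (1 - Fₙ(m)) + (1 - τ) Fₙ(m)`, up to an error of at most `(x - m) νₙ(m, x)`; for `x < m` the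
same holds with `Fₙ(m-)` and `νₙ(x, m)`. Since `λₙ(μ̂) = 0`, it follows that `μ̂ - m` equals the
two-slope function of `λₙ(m)` up to a relative error controlled by `Fₙ(m) - F(m)`,
`Fₙ(m-) - F(m-)` and the empirical mass of an open interval between `m` and `μ̂`
(`abs_sub_twoSlope_le`). The strong law of large numbers, used for the sign of `λₙ` near `m` and
for countably many such intervals, makes this relative error vanish almost surely
(`tendsto_relative_error`). The two-slope function is positively homogeneous, so
`√n (μ̂ - m) = twoSlope Zₙ + rₙ Zₙ` with `Zₙ = √n λₙ(m)` and `rₙ → 0` almost surely. The central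
limit theorem for `Zₙ` and Slutsky's theorem finish the convergence. An atom at `m` only makes the
two slopes different, so no continuity of `F` is involved.

If the slopes differ and the Gaussian variable is nondegenerate, the median of the limit law is `0`,
so that a normal limit would have to be symmetric about `0`; the unequal tails of the limit law
exclude this (`map_twoSlope_gaussianReal_ne`).
-/

namespace Expectile

/-! ### The score and the identification function -/

lemma ident_eq (τ x y : ℝ) : ident τ x y = τ * max (y - x) 0 - (1 - τ) * max (x - y) 0 := by
  unfold ident
  rcases lt_or_ge y x with h | h
  · rw [max_eq_right (by linarith), max_eq_left (by linarith)]
    simp [h, not_le.2 h]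
  · rw [max_eq_left (by linarith), max_eq_right (by linarith)]
    simp [h, not_lt.2 h]

lemma score_eq (τ x y : ℝ) : score τ x y =
    τ / 2 * (max (y - x) 0 ^ 2 - max y 0 ^ 2)
      + (1 - τ) / 2 * (max (x - y) 0 ^ 2 - max (-y) 0 ^ 2) := by
  simp [score, posPart_def, negPart_def]

lemma ident_of_le {τ x y : ℝ} (h : x ≤ y) : ident τ x y = τ * (y - x) := by
  simp [ident, h, not_lt.2 h]

lemma ident_of_ge {τ x y : ℝ} (h : y ≤ x) : ident τ x y = (1 - τ) * (y - x) := by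
  rcases h.eq_or_lt with rfl | h
  · simp [ident]
  · simp only [ident, not_le.2 h, h, if_true, if_false]; ring

@[simp]
lemma score_zero_left (τ y : ℝ) : score τ 0 y = 0 := by simp [score]

@[fun_prop]
lemma continuous_ident_uncurry (τ : ℝ) : Continuous fun p : ℝ × ℝ => ident τ p.1 p.2 := by
  simp_rw [ident_eq]; fun_prop

@[fun_prop]
lemma measurable_ident (τ x : ℝ) : Measurable (ident τ x) :=
  ((continuous_ident_uncurry τ).comp (by fun_prop : Continuous fun y : ℝ => (x, y))).measurable

lemma measurable_score (τ x : ℝ) : Measurable (score τ x) := by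
  have : Continuous (score τ x) := by
    rw [show score τ x = _ from funext (score_eq τ x)]; fun_prop
  exact this.measurable

variable {τ c : ℝ}

/-- The identification function decreases in its first argument, with slope at least `c`. -/
lemma mul_sub_le_ident_sub (h1 : c ≤ τ) (h2 : c ≤ 1 - τ) {x x' : ℝ} (h : x ≤ x') (y : ℝ) :
    c * (x' - x) ≤ ident τ x y - ident τ x' y := by
  rcases le_total y x with hx | hx
  · rw [ident_of_ge hx, ident_of_ge (hx.trans h)]; nlinarith
  · rcases le_total y x' with hx' | hx'
    · rw [ident_of_le hx, ident_of_ge hx']; nlinarith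
    · rw [ident_of_le hx, ident_of_le hx']; nlinarith

/-- The identification function decreases in its first argument, with slope at most `1`. -/
lemma ident_sub_le (h1 : 0 ≤ τ) (h2 : τ ≤ 1) {x x' : ℝ} (h : x ≤ x') (y : ℝ) :
    ident τ x y - ident τ x' y ≤ x' - x := by
  rcases le_total y x with hx | hx
  · rw [ident_of_ge hx, ident_of_ge (hx.trans h)]; nlinarith
  · rcases le_total y x' with hx' | hx'
    · rw [ident_of_le hx, ident_of_ge hx']; nlinarith
    · rw [ident_of_le hx, ident_of_le hx']; nlinarith

/-- The score is `c`-strongly convex in its first argument, with derivative minus the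
identification function. -/
lemma le_score_sub (h1 : c ≤ τ) (h2 : c ≤ 1 - τ) (x z y : ℝ) :
    -(z - x) * ident τ x y + c / 2 * (z - x) ^ 2 ≤ score τ z y - score τ x y := by
  rw [score_eq, score_eq]
  rcases le_total y x with hx | hx <;> rcases le_total y z with hz | hz
  · rw [ident_of_ge hx, max_eq_right (a := y - z) (by linarith),
      max_eq_right (a := y - x) (by linarith),
      max_eq_left (a := z - y) (by linarith), max_eq_left (a := x - y) (by linarith)]
    nlinarith [sq_nonneg (z - x)]
  · rw [ident_of_ge hx, max_eq_left (a := y - z) (by linarith),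
      max_eq_right (a := y - x) (by linarith),
      max_eq_right (a := z - y) (by linarith), max_eq_left (a := x - y) (by linarith)]
    nlinarith [mul_nonneg (sub_nonneg.2 h1) (sq_nonneg (y - z)),
      mul_nonneg (sub_nonneg.2 h2) (sq_nonneg (y - x)),
      mul_nonneg (sub_nonneg.2 h2) (mul_nonneg (sub_nonneg.2 hz) (sub_nonneg.2 hx))]
  · rw [ident_of_le hx, max_eq_right (a := y - z) (by linarith),
      max_eq_left (a := y - x) (by linarith),
      max_eq_left (a := z - y) (by linarith), max_eq_right (a := x - y) (by linarith)]
    nlinarith [mul_nonneg (sub_nonneg.2 h2) (sq_nonneg (y - z)),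
      mul_nonneg (sub_nonneg.2 h1) (sq_nonneg (y - x)),
      mul_nonneg (sub_nonneg.2 h1) (mul_nonneg (sub_nonneg.2 hz) (sub_nonneg.2 hx))]
  · rw [ident_of_le hx, max_eq_left (a := y - z) (by linarith),
      max_eq_left (a := y - x) (by linarith),
      max_eq_right (a := z - y) (by linarith), max_eq_right (a := x - y) (by linarith)]
    nlinarith [sq_nonneg (z - x)]

lemma score_le (h1 : 0 ≤ τ) (h2 : τ ≤ 1) (x y : ℝ) :
    score τ x y ≤ -x * ident τ 0 y + x ^ 2 / 2 := by
  rw [score_eq]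
  rcases le_total y 0 with hx | hx <;> rcases le_total y x with hz | hz
  · rw [ident_of_ge hx, max_eq_right (a := y - x) (by linarith), max_eq_right (a := y) hx,
      max_eq_left (a := x - y) (by linarith), max_eq_left (a := -y) (by linarith)]
    nlinarith [sq_nonneg x]
  · rw [ident_of_ge hx, max_eq_left (a := y - x) (by linarith), max_eq_right (a := y) hx,
      max_eq_right (a := x - y) (by linarith), max_eq_left (a := -y) (by linarith)]
    nlinarith [mul_nonneg (sub_nonneg.2 h2) (sq_nonneg (y - x)), mul_nonneg h1 (sq_nonneg y),
      mul_nonneg h1 (mul_nonneg (sub_nonneg.2 hz) (neg_nonneg.2 hx))]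
  · rw [ident_of_le hx, max_eq_right (a := y - x) (by linarith), max_eq_left (a := y) hx,
      max_eq_left (a := x - y) (by linarith), max_eq_right (a := -y) (by linarith)]
    nlinarith [mul_nonneg h1 (sq_nonneg (y - x)), mul_nonneg (sub_nonneg.2 h2) (sq_nonneg y),
      mul_nonneg (sub_nonneg.2 h2) (mul_nonneg (sub_nonneg.2 hz) hx)]
  · rw [ident_of_le hx, max_eq_left (a := y - x) (by linarith), max_eq_left (a := y) hx,
      max_eq_right (a := x - y) (by linarith), max_eq_right (a := -y) (by linarith)]
    nlinarith [sq_nonneg x]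

/-- Expansion to the right of `m`; the remainder lives on the observations strictly between the
two points. -/
lemma abs_ident_sub_right (h1 : 0 ≤ τ) (h2 : τ ≤ 1) {m x : ℝ} (h : m ≤ x) (y : ℝ) :
    |ident τ m y - ident τ x y
      - (x - m) * (τ * (1 - (Iic m).indicator 1 y) + (1 - τ) * (Iic m).indicator 1 y)|
      ≤ (x - m) * (Ioo m x).indicator 1 y := by
  rcases le_or_gt y m with hm | hm
  · simp only [mem_Iic, hm, indicator_of_mem, mem_Ioo, not_lt.2 hm, false_and,
      not_false_eq_true, indicator_of_notMem, Pi.one_apply]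
    rw [ident_of_ge hm, ident_of_ge (hm.trans h), abs_le]
    constructor <;> nlinarith
  · rcases lt_or_ge y x with hx | hx
    · simp only [mem_Iic, not_le.2 hm, not_false_eq_true, indicator_of_notMem, mem_Ioo, hm, hx,
        and_self, indicator_of_mem, Pi.one_apply]
      rw [ident_of_le hm.le, ident_of_ge hx.le, abs_le]
      constructor <;> nlinarith
    · simp only [mem_Iic, not_le.2 hm, not_false_eq_true, indicator_of_notMem, mem_Ioo, hm,
        not_lt.2 hx, and_false]
      rw [ident_of_le hm.le, ident_of_le hx, abs_le]
      constructor <;> nlinarith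

/-- Expansion to the left of `m`; the remainder lives on the observations strictly between the
two points. -/
lemma abs_ident_sub_left (h1 : 0 ≤ τ) (h2 : τ ≤ 1) {m x : ℝ} (h : x ≤ m) (y : ℝ) :
    |ident τ m y - ident τ x y
      - (x - m) * (τ * (1 - (Iio m).indicator 1 y) + (1 - τ) * (Iio m).indicator 1 y)|
      ≤ (m - x) * (Ioo x m).indicator 1 y := by
  rcases le_or_gt m y with hm | hm
  · simp only [mem_Iio, not_lt.2 hm, not_false_eq_true, indicator_of_notMem, mem_Ioo, and_false]
    rw [ident_of_le hm, ident_of_le (h.trans hm), abs_le]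
    constructor <;> nlinarith
  · rcases lt_or_ge x y with hx | hx
    · simp only [mem_Iio, mem_Ioo, hm, hx, and_self, indicator_of_mem, Pi.one_apply]
      rw [ident_of_ge hm.le, ident_of_le hx.le, abs_le]
      constructor <;> nlinarith
    · simp only [mem_Iio, hm, mem_Ioo, not_lt.2 hx, false_and, not_false_eq_true,
        indicator_of_notMem, indicator_of_mem, Pi.one_apply]
      rw [ident_of_ge hm.le, ident_of_ge hx, abs_le]
      constructor <;> nlinarith

/-! ### Expectiles of a distribution with finite mean -/

/-- The expected identification function `x ↦ ∫ I_τ(x, y) dν(y)`. -/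
noncomputable def meanIdent (τ : ℝ) (ν : Measure ℝ) (x : ℝ) : ℝ := ∫ y, ident τ x y ∂ν

/-- Minus the right derivative at `x` of the expected identification function,
`τ (1 - F(x)) + (1 - τ) F(x)`. -/
noncomputable def rightSlope (τ : ℝ) (ν : Measure ℝ) (x : ℝ) : ℝ :=
  τ * (1 - ν.real (Iic x)) + (1 - τ) * ν.real (Iic x)

/-- Minus the left derivative at `x` of the expected identification function,
`τ (1 - F(x-)) + (1 - τ) F(x-)`. -/
noncomputable def leftSlope (τ : ℝ) (ν : Measure ℝ) (x : ℝ) : ℝ :=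
  τ * (1 - ν.real (Iio x)) + (1 - τ) * ν.real (Iio x)

lemma sigmaTwo_eq (τ : ℝ) (ν : Measure ℝ) (x : ℝ) : sigmaTwo τ ν x = 1 / leftSlope τ ν x := rfl

variable {ν : Measure ℝ} [IsProbabilityMeasure ν]

lemma sigmaOne_eq (τ x : ℝ) : sigmaOne τ ν x = 1 / rightSlope τ ν x := by
  rw [sigmaOne, rightSlope, cdf_eq_real]

lemma le_rightSlope (h1 : c ≤ τ) (h2 : c ≤ 1 - τ) (x : ℝ) : c ≤ rightSlope τ ν x := by
  have h := measureReal_nonneg (μ := ν) (s := Iic x)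
  have h' := measureReal_le_one (μ := ν) (s := Iic x)
  unfold rightSlope
  nlinarith

lemma le_leftSlope (h1 : c ≤ τ) (h2 : c ≤ 1 - τ) (x : ℝ) : c ≤ leftSlope τ ν x := by
  have h := measureReal_nonneg (μ := ν) (s := Iio x)
  have h' := measureReal_le_one (μ := ν) (s := Iio x)
  unfold leftSlope
  nlinarith

lemma integrable_ident (hν : Integrable id ν) (τ x : ℝ) : Integrable (ident τ x) ν := by
  have h1 : Integrable (fun y : ℝ => y - x) ν := hν.sub (integrable_const x)
  have h2 : Integrable (fun y : ℝ => x - y) ν := (integrable_const x).sub hν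
  rw [show ident τ x = _ from funext (ident_eq τ x)]
  exact (h1.pos_part.const_mul τ).sub (h2.pos_part.const_mul (1 - τ))

lemma integrable_score (hν : Integrable id ν) (h0 : 0 ≤ τ) (h1 : τ ≤ 1) (x : ℝ) :
    Integrable (score τ x) ν := by
  have hi := (integrable_ident hν τ 0).const_mul (-x)
  refine Integrable.mono' (hi.abs.add (integrable_const (x ^ 2 / 2)))
    (measurable_score τ x).aestronglyMeasurable (ae_of_all _ fun y => ?_)
  have hl := le_score_sub (c := 0) h0 (by linarith) 0 x y
  have hu := score_le h0 h1 x y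
  simp only [score_zero_left, sub_zero, zero_div, zero_mul, add_zero] at hl
  have := neg_abs_le (-x * ident τ 0 y)
  have := le_abs_self (-x * ident τ 0 y)
  have := sq_nonneg x
  simp only [Pi.add_apply, Real.norm_eq_abs]
  rw [abs_le]
  constructor <;> linarith

lemma mul_sub_le_meanIdent_sub (hν : Integrable id ν) (h1 : c ≤ τ) (h2 : c ≤ 1 - τ) {x x' : ℝ}
    (h : x ≤ x') : c * (x' - x) ≤ meanIdent τ ν x - meanIdent τ ν x' := by
  rw [meanIdent, meanIdent, ← integral_sub (integrable_ident hν τ x) (integrable_ident hν τ x')]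
  have := integral_mono (μ := ν) (integrable_const (c * (x' - x)))
    ((integrable_ident hν τ x).sub (integrable_ident hν τ x'))
    (mul_sub_le_ident_sub h1 h2 h)
  simpa using this

lemma meanIdent_sub_le (hν : Integrable id ν) (h0 : 0 ≤ τ) (h1 : τ ≤ 1) {x x' : ℝ}
    (h : x ≤ x') : meanIdent τ ν x - meanIdent τ ν x' ≤ x' - x := by
  rw [meanIdent, meanIdent, ← integral_sub (integrable_ident hν τ x) (integrable_ident hν τ x')]
  have := integral_mono (μ := ν) ((integrable_ident hν τ x).sub (integrable_ident hν τ x'))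
    (integrable_const (x' - x)) (ident_sub_le h0 h1 h)
  simpa using this

lemma strictAnti_meanIdent (hν : Integrable id ν) (hτ : τ ∈ Ioo (0 : ℝ) 1) :
    StrictAnti (meanIdent τ ν) := fun x x' h => by
  have hc : 0 < min τ (1 - τ) := lt_min hτ.1 (by linarith [hτ.2])
  have := mul_sub_le_meanIdent_sub hν (min_le_left τ (1 - τ)) (min_le_right _ _) h.le
  nlinarith [mul_pos hc (sub_pos.2 h)]

lemma continuous_meanIdent (hν : Integrable id ν) (hτ : τ ∈ Ioo (0 : ℝ) 1) :
    Continuous (meanIdent τ ν) := by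
  have hanti := (strictAnti_meanIdent hν hτ).antitone
  refine LipschitzWith.continuous (K := 1) (LipschitzWith.of_dist_le_mul fun x x' => ?_)
  rw [NNReal.coe_one, one_mul, Real.dist_eq, Real.dist_eq]
  rcases le_total x x' with h | h
  · rw [abs_of_nonneg (sub_nonneg.2 (hanti h)), abs_sub_comm, abs_of_nonneg (sub_nonneg.2 h)]
    exact meanIdent_sub_le hν hτ.1.le hτ.2.le h
  · rw [abs_sub_comm, abs_of_nonneg (sub_nonneg.2 (hanti h)), abs_of_nonneg (sub_nonneg.2 h)]
    exact meanIdent_sub_le hν hτ.1.le hτ.2.le h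

lemma exists_meanIdent_eq_zero (hν : Integrable id ν) (hτ : τ ∈ Ioo (0 : ℝ) 1) :
    ∃ x, meanIdent τ ν x = 0 := by
  have hc : 0 < min τ (1 - τ) := lt_min hτ.1 (by linarith [hτ.2])
  set c := min τ (1 - τ)
  have key {x x' : ℝ} (h : x ≤ x') :=
    mul_sub_le_meanIdent_sub hν (min_le_left τ (1 - τ)) (min_le_right _ _) h
  -- The slope is at most `-c`, so the sign changes within distance `|meanIdent τ ν 0| / c` of `0`.
  set d := |meanIdent τ ν 0| / c
  have hd : 0 ≤ d := by positivity
  have hcd : c * d = |meanIdent τ ν 0| := mul_div_cancel₀ _ hc.ne'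
  refine mem_range_of_exists_le_of_exists_ge (continuous_meanIdent hν hτ) ⟨d, ?_⟩ ⟨-d, ?_⟩
  · have := key hd
    have := le_abs_self (meanIdent τ ν 0)
    simp only [sub_zero] at *
    linarith
  · have := key (neg_nonpos.2 hd)
    have := neg_abs_le (meanIdent τ ν 0)
    simp only [zero_sub, neg_neg] at *
    linarith

/-- Strong convexity makes a zero of the expected identification function the only minimizer of
the expected score. -/
lemma isExpectile_iff_of_meanIdent_eq_zero (hν : Integrable id ν) (hτ : τ ∈ Ioo (0 : ℝ) 1)
    {x : ℝ} (hx : meanIdent τ ν x = 0) (z : ℝ) : IsExpectile τ ν z ↔ z = x := by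
  have hc : 0 < min τ (1 - τ) := lt_min hτ.1 (by linarith [hτ.2])
  set c := min τ (1 - τ)
  have hs := integrable_score hν hτ.1.le hτ.2.le
  have key (z : ℝ) : c / 2 * (z - x) ^ 2 ≤ ∫ y, score τ z y ∂ν - ∫ y, score τ x y ∂ν := by
    have h := integral_mono (μ := ν)
      (((integrable_ident hν τ x).const_mul (-(z - x))).add
        (integrable_const (c / 2 * (z - x) ^ 2)))
      ((hs z).sub (hs x)) (le_score_sub (min_le_left τ (1 - τ)) (min_le_right _ _) x z)
    simp only [Pi.add_apply, Pi.sub_apply] at h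
    rw [integral_add ((integrable_ident hν τ x).const_mul _) (integrable_const _),
      integral_const_mul, integral_sub (hs z) (hs x)] at h
    rw [meanIdent] at hx
    simpa [hx] using h
  constructor
  · intro hz
    have h1 := key z
    have h2 := hz x
    have h3 : (z - x) ^ 2 = 0 := by nlinarith [sq_nonneg (z - x)]
    exact sub_eq_zero.1 (pow_eq_zero_iff two_ne_zero |>.1 h3)
  · rintro rfl w
    have := key w
    have : 0 ≤ c / 2 * (w - z) ^ 2 := by positivity
    linarith

lemma existsUnique_isExpectile (hν : Integrable id ν) (hτ : τ ∈ Ioo (0 : ℝ) 1) :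
    ∃! x, IsExpectile τ ν x := by
  obtain ⟨x, hx⟩ := exists_meanIdent_eq_zero hν hτ
  have h := isExpectile_iff_of_meanIdent_eq_zero hν hτ hx
  exact ⟨x, (h x).2 rfl, fun z hz => (h z).1 hz⟩

lemma meanIdent_expectile (hν : Integrable id ν) (hτ : τ ∈ Ioo (0 : ℝ) 1) :
    meanIdent τ ν (expectile τ ν) = 0 := by
  obtain ⟨x, hx⟩ := exists_meanIdent_eq_zero hν hτ
  have h := isExpectile_iff_of_meanIdent_eq_zero hν hτ hx
  have he : IsExpectile τ ν (expectile τ ν) := Classical.epsilon_spec ⟨x, (h x).2 rfl⟩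
  rwa [(h _).1 he]

lemma expectile_le_iff (hν : Integrable id ν) (hτ : τ ∈ Ioo (0 : ℝ) 1) (x : ℝ) :
    expectile τ ν ≤ x ↔ meanIdent τ ν x ≤ 0 := by
  rw [← meanIdent_expectile hν hτ, (strictAnti_meanIdent hν hτ).le_iff_ge]

lemma integral_slope {s : Set ℝ} (hs : MeasurableSet s) (τ a : ℝ) :
    ∫ y, a * (τ * (1 - s.indicator 1 y) + (1 - τ) * s.indicator 1 y) ∂ν
      = a * (τ * (1 - ν.real s) + (1 - τ) * ν.real s) := by
  have hi : Integrable (s.indicator (1 : ℝ → ℝ)) ν := (integrable_const (1 : ℝ)).indicator hs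
  have hi' : Integrable (fun y => 1 - s.indicator (1 : ℝ → ℝ) y) ν := (integrable_const 1).sub hi
  rw [integral_const_mul, integral_add (hi'.const_mul τ)
    (hi.const_mul (1 - τ)), integral_const_mul, integral_const_mul,
    integral_sub (integrable_const 1) hi, integral_indicator_one hs]
  simp

lemma abs_meanIdent_sub_le_of_indicator (hν : Integrable id ν) {s t : Set ℝ}
    (hs : MeasurableSet s) (ht : MeasurableSet t) {x m b : ℝ}
    (h : ∀ y, |ident τ m y - ident τ x y
      - (x - m) * (τ * (1 - s.indicator 1 y) + (1 - τ) * s.indicator 1 y)|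
      ≤ b * t.indicator 1 y) :
    |meanIdent τ ν m - meanIdent τ ν x
      - (x - m) * (τ * (1 - ν.real s) + (1 - τ) * ν.real s)| ≤ b * ν.real t := by
  have his : Integrable (s.indicator (1 : ℝ → ℝ)) ν := (integrable_const (1 : ℝ)).indicator hs
  have hit : Integrable (t.indicator (1 : ℝ → ℝ)) ν := (integrable_const (1 : ℝ)).indicator ht
  have hd := (integrable_ident hν τ m).sub (integrable_ident hν τ x)
  have hsl := (((integrable_const 1).sub his).const_mul τ |>.add
    (his.const_mul (1 - τ))).const_mul (x - m)
  rw [← integral_slope hs, meanIdent, meanIdent,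
    ← integral_sub (integrable_ident hν τ m) (integrable_ident hν τ x)]
  refine (congrArg abs (integral_sub hd hsl)).symm.le.trans ?_
  refine (abs_integral_le_integral_abs).trans ((integral_mono (hd.sub hsl).abs
    (hit.const_mul b) h).trans_eq ?_)
  rw [integral_const_mul, integral_indicator_one ht]

/-! ### The deterministic linearization -/

lemma twoSlope_of_nonneg {a b w : ℝ} (h : 0 ≤ w) : twoSlope a b w = a * w := by
  rcases h.eq_or_lt with rfl | h
  · simp [twoSlope]
  · simp [twoSlope, h, h.not_gt]

lemma twoSlope_of_nonpos {a b w : ℝ} (h : w ≤ 0) : twoSlope a b w = b * w := by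
  rcases h.eq_or_lt with rfl | h
  · simp [twoSlope]
  · simp [twoSlope, h, h.not_gt]

lemma twoSlope_mul_left {a b k w : ℝ} (hk : 0 ≤ k) : twoSlope a b (k * w) = k * twoSlope a b w := by
  rcases le_total 0 w with h | h
  · rw [twoSlope_of_nonneg h, twoSlope_of_nonneg (mul_nonneg hk h)]; ring
  · rw [twoSlope_of_nonpos h, twoSlope_of_nonpos (mul_nonpos_of_nonneg_of_nonpos hk h)]; ring

@[fun_prop]
lemma continuous_twoSlope (a b : ℝ) : Continuous (twoSlope a b) := by
  have : twoSlope a b = fun w => a * max w 0 + b * min w 0 := by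
    funext w
    rcases le_total 0 w with h | h
    · simp [twoSlope_of_nonneg, h]
    · simp [twoSlope_of_nonpos, h]
  rw [this]; fun_prop

/-- If `x` is the zero of the expected identification function of `ν`, then `x - m` equals the
two-slope function of its value at `m` up to a small relative error. The slopes `1 / A` and `1 / B`
may belong to another distribution, with one-sided slopes close to those of `ν`. -/
lemma abs_sub_twoSlope_le (hν : Integrable id ν) (hτ : τ ∈ Ioo (0 : ℝ) 1) (hc : 0 < c)
    (h1 : c ≤ τ) (h2 : c ≤ 1 - τ) {A B m x η : ℝ} (hA : c ≤ A) (hB : c ≤ B)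
    (hx : meanIdent τ ν x = 0)
    (hr : |rightSlope τ ν m - A| + ν.real (Ioo m x) ≤ η)
    (hl : |leftSlope τ ν m - B| + ν.real (Ioo x m) ≤ η) :
    |(x - m) - twoSlope (1 / A) (1 / B) (meanIdent τ ν m)| ≤ η / c ^ 2 * |meanIdent τ ν m| := by
  set L := meanIdent τ ν m with hL
  -- In both cases `|L - d S| ≤ |d| η` for `d = x - m` and `S` the slope, and `c |d| ≤ |L|`.
  have main {S d : ℝ} (hS : c ≤ S) (hdL : c * |d| ≤ |L|) (h : |L - d * S| ≤ |d| * η) :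
      |d - 1 / S * L| ≤ η / c ^ 2 * |L| := by
    have hS0 : 0 < S := hc.trans_le hS
    have hη : 0 ≤ η := by
      have := abs_nonneg (rightSlope τ ν m - A)
      have := measureReal_nonneg (μ := ν) (s := Ioo m x)
      linarith
    have e : d - 1 / S * L = -((L - d * S) / S) := by field_simp; ring
    rw [e, abs_neg, abs_div, abs_of_pos hS0]
    calc |L - d * S| / S ≤ (|d| * η) / c := by gcongr
      _ ≤ ((|L| / c) * η) / c := by
        gcongr
        rw [le_div_iff₀ hc]; linarith
      _ = η / c ^ 2 * |L| := by field_simp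
  rcases le_total m x with h | h
  · have hm := mul_sub_le_meanIdent_sub hν h1 h2 h
    have hd : 0 ≤ x - m := sub_nonneg.2 h
    rw [hx, sub_zero, ← hL] at hm
    have hL0 : 0 ≤ L := le_trans (by positivity) hm
    rw [twoSlope_of_nonneg hL0]
    refine main hA (by rwa [abs_of_nonneg hd, abs_of_nonneg hL0]) ?_
    have hb := abs_meanIdent_sub_le_of_indicator hν measurableSet_Iic measurableSet_Ioo
      (abs_ident_sub_right hτ.1.le hτ.2.le h)
    change |meanIdent τ ν m - meanIdent τ ν x - (x - m) * rightSlope τ ν m| ≤ _ at hb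
    rw [hx, sub_zero, ← hL] at hb
    calc |L - (x - m) * A|
        = |(L - (x - m) * rightSlope τ ν m) + (x - m) * (rightSlope τ ν m - A)| := by ring_nf
      _ ≤ (x - m) * ν.real (Ioo m x) + (x - m) * |rightSlope τ ν m - A| := by
        refine (abs_add_le _ _).trans (add_le_add hb ?_)
        rw [abs_mul, abs_of_nonneg hd]
      _ ≤ |x - m| * η := by
        rw [abs_of_nonneg hd, ← mul_add, add_comm]
        gcongr
  · have hm := mul_sub_le_meanIdent_sub hν h1 h2 h
    have hd : 0 ≤ m - x := sub_nonneg.2 h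
    rw [hx, zero_sub, ← hL] at hm
    have hL0 : L ≤ 0 := by linarith [mul_nonneg hc.le hd]
    rw [twoSlope_of_nonpos hL0]
    have hd' : |x - m| = m - x := by rw [abs_sub_comm, abs_of_nonneg hd]
    refine main hB (by rwa [hd', abs_of_nonpos hL0]) ?_
    have hb := abs_meanIdent_sub_le_of_indicator hν measurableSet_Iio measurableSet_Ioo
      (abs_ident_sub_left hτ.1.le hτ.2.le h)
    change |meanIdent τ ν m - meanIdent τ ν x - (x - m) * leftSlope τ ν m| ≤ _ at hb
    rw [hx, sub_zero, ← hL] at hb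
    calc |L - (x - m) * B|
        = |(L - (x - m) * leftSlope τ ν m) + (x - m) * (leftSlope τ ν m - B)| := by ring_nf
      _ ≤ (m - x) * ν.real (Ioo x m) + (m - x) * |leftSlope τ ν m - B| := by
        refine (abs_add_le _ _).trans (add_le_add hb ?_)
        rw [abs_mul, hd']
      _ ≤ |x - m| * η := by
        rw [hd', ← mul_add, add_comm]
        gcongr

end Expectile

namespace Expectile

/-! ### Empirical distributions -/

variable {τ : ℝ}

lemma integrable_empiricalMeasure {n : ℕ} (hn : 1 ≤ n) (y : ℕ → ℝ) (f : ℝ → ℝ) :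
    Integrable f (empiricalMeasure n y) := by
  refine Integrable.smul_measure ?_ (by simp; omega)
  exact integrable_finsetSum_measure.2 fun k _ => integrable_dirac (by simp)

lemma isProbabilityMeasure_empiricalMeasure {n : ℕ} (hn : 1 ≤ n) (y : ℕ → ℝ) :
    IsProbabilityMeasure (empiricalMeasure n y) := by
  constructor
  simp only [empiricalMeasure, Measure.smul_apply, Measure.coe_finsetSum, Finset.sum_apply,
    measure_univ, Finset.sum_const, Finset.card_range, smul_eq_mul, nsmul_eq_mul, mul_one]
  exact ENNReal.inv_mul_cancel (by simp; omega) (by simp)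

lemma integral_empiricalMeasure (n : ℕ) (y : ℕ → ℝ) (f : ℝ → ℝ) :
    ∫ x, f x ∂(empiricalMeasure n y) = (n : ℝ)⁻¹ * ∑ k ∈ Finset.range n, f (y k) := by
  rw [empiricalMeasure, integral_smul_measure,
    integral_finsetSum_measure fun k _ => integrable_dirac (by simp)]
  simp

lemma measurable_meanIdent_empiricalMeasure (τ : ℝ) (n : ℕ) (x : ℝ) :
    Measurable fun y : ℕ → ℝ => meanIdent τ (empiricalMeasure n y) x := by
  simp_rw [meanIdent, integral_empiricalMeasure]
  exact (Finset.measurable_fun_sum _ fun k _ =>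
    (measurable_ident τ x).comp (measurable_pi_apply k)).const_mul _

/-- The sample expectile is a measurable function of the sample, because its sublevel sets are
those on which the empirical mean of the identification function is nonpositive. -/
lemma measurable_sampleExpectile (hτ : τ ∈ Ioo (0 : ℝ) 1) (n : ℕ) :
    Measurable (sampleExpectile τ n) := by
  rcases Nat.eq_zero_or_pos n with rfl | hn
  · have : sampleExpectile τ 0 = fun _ => expectile τ 0 := by
      funext y; simp [sampleExpectile, empiricalMeasure]
    rw [this]; exact measurable_const
  · refine measurable_of_Iic fun x => ?_
    have : sampleExpectile τ n ⁻¹' Iic x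
        = (fun y : ℕ → ℝ => meanIdent τ (empiricalMeasure n y) x) ⁻¹' Iic 0 := by
      ext y
      have := isProbabilityMeasure_empiricalMeasure hn y
      exact expectile_le_iff (integrable_empiricalMeasure hn y id) hτ x
    rw [this]
    exact measurable_meanIdent_empiricalMeasure τ n x measurableSet_Iic

/-! ### Strong laws for the empirical distribution -/

section StrongLaw

variable {Ω : Type*} [MeasurableSpace Ω] {P : Measure Ω}
  {Ys : ℕ → Ω → ℝ} {ν : Measure ℝ}

lemma tendsto_integral_empiricalMeasure (hindep : iIndepFun Ys P)
    (hlaw : ∀ k, HasLaw (Ys k) ν P) {f : ℝ → ℝ} (hf : Measurable f) (hfi : Integrable f ν) :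
    ∀ᵐ ω ∂P, Tendsto (fun n : ℕ => ∫ x, f x ∂(empiricalMeasure n fun k => Ys k ω)) atTop
      (𝓝 (∫ x, f x ∂ν)) := by
  have h0 : ∀ k, AEMeasurable (Ys k) P := fun k => (hlaw k).aemeasurable
  have hid : ∀ k, IdentDistrib (fun ω => f (Ys k ω)) (fun ω => f (Ys 0 ω)) P P := fun k =>
    IdentDistrib.comp ⟨h0 k, h0 0, by rw [(hlaw k).map_eq, (hlaw 0).map_eq]⟩ hf
  have hint : Integrable (fun ω => f (Ys 0 ω)) P := by
    rw [← (hlaw 0).map_eq] at hfi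
    exact hfi.comp_aemeasurable (h0 0)
  have hpair : Pairwise fun i j => IndepFun (fun ω => f (Ys i ω)) (fun ω => f (Ys j ω)) P :=
    fun i j hij => (hindep.indepFun hij).comp hf hf
  have hmean : ∫ ω, f (Ys 0 ω) ∂P = ∫ x, f x ∂ν := by
    rw [← (hlaw 0).map_eq, integral_map (h0 0) hf.aestronglyMeasurable]
  filter_upwards [strong_law_ae_real _ hint hpair hid] with ω hω
  rw [hmean] at hω
  refine hω.congr fun n => ?_
  rw [integral_empiricalMeasure, div_eq_inv_mul]

lemma tendsto_real_empiricalMeasure [IsProbabilityMeasure ν] (hindep : iIndepFun Ys P)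
    (hlaw : ∀ k, HasLaw (Ys k) ν P) {s : Set ℝ} (hs : MeasurableSet s) :
    ∀ᵐ ω ∂P, Tendsto (fun n : ℕ => (empiricalMeasure n fun k => Ys k ω).real s) atTop
      (𝓝 (ν.real s)) := by
  have := tendsto_integral_empiricalMeasure hindep hlaw (f := s.indicator 1)
    (measurable_one.indicator hs) ((integrable_const (1 : ℝ)).indicator hs)
  simpa only [integral_indicator_one hs] using this

lemma tendsto_sampleExpectile [IsProbabilityMeasure ν] (hindep : iIndepFun Ys P)
    (hlaw : ∀ k, HasLaw (Ys k) ν P) (hν : Integrable id ν) (hτ : τ ∈ Ioo (0 : ℝ) 1) {m : ℝ}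
    (hm : meanIdent τ ν m = 0) :
    ∀ᵐ ω ∂P, Tendsto (fun n : ℕ => sampleExpectile τ n fun k => Ys k ω) atTop (𝓝 m) := by
  have hpt (x : ℝ) := tendsto_integral_empiricalMeasure hindep hlaw (measurable_ident τ x)
    (integrable_ident hν τ x)
  have hanti := strictAnti_meanIdent hν hτ
  have hr : ∀ᵐ ω ∂P, ∀ j : ℕ, _ := ae_all_iff.2 fun j : ℕ => hpt (m + 1 / ((j : ℝ) + 1))
  have hl : ∀ᵐ ω ∂P, ∀ j : ℕ, _ := ae_all_iff.2 fun j : ℕ => hpt (m - 1 / ((j : ℝ) + 1))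
  filter_upwards [hr, hl] with ω hrω hlω
  refine Metric.tendsto_nhds.2 fun ε hε => ?_
  obtain ⟨j, hj⟩ := exists_nat_one_div_lt hε
  have hj0 : (0 : ℝ) < 1 / ((j : ℝ) + 1) := by positivity
  have h1 : meanIdent τ ν (m + 1 / ((j : ℝ) + 1)) < 0 := hm ▸ hanti (by linarith)
  have h2 : 0 < meanIdent τ ν (m - 1 / ((j : ℝ) + 1)) := hm ▸ hanti (by linarith)
  filter_upwards [(hrω j).eventually (gt_mem_nhds h1), (hlω j).eventually (lt_mem_nhds h2),
    eventually_ge_atTop 1] with n hn1 hn2 hn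
  have := isProbabilityMeasure_empiricalMeasure hn fun k => Ys k ω
  have hle := expectile_le_iff (integrable_empiricalMeasure hn (fun k => Ys k ω) id) hτ
  have a1 := (hle (m + 1 / ((j : ℝ) + 1))).2 hn1.le
  have a2 := not_le.1 (mt (hle (m - 1 / ((j : ℝ) + 1))).1 (not_le.2 hn2))
  rw [Real.dist_eq, abs_lt, sampleExpectile]
  constructor <;> linarith

/-- Intervals with endpoint `m`, excluded, have small mass. -/
lemma exists_real_Ioo_lt (ν : Measure ℝ) [IsProbabilityMeasure ν] (m : ℝ) {η : ℝ} (hη : 0 < η) :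
    ∃ δ > 0, ν.real (Ioo m (m + δ)) < η ∧ ν.real (Ioo (m - δ) m) < η := by
  have hlim (s : ℝ → Set ℝ) (hs : ∀ δ, MeasurableSet (s δ)) (hmono : Monotone s)
      (hempty : ∀ x, ∃ δ > 0, x ∉ s δ) : ∀ᶠ δ in 𝓝[>] (0 : ℝ), ν.real (s δ) < η := by
    have h := tendsto_measure_biInter_gt (μ := ν) (s := s) (a := 0)
      (fun r _ => (hs r).nullMeasurableSet) (fun i j _ hij => hmono hij)
      ⟨1, one_pos, measure_ne_top _ _⟩
    have he : ⋂ r, ⋂ (_ : r > 0), s r = ∅ := by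
      refine eq_empty_of_forall_notMem fun x hx => ?_
      obtain ⟨δ, hδ, hxδ⟩ := hempty x
      exact hxδ (mem_iInter₂.1 hx δ hδ)
    rw [he, measure_empty] at h
    have h' := (ENNReal.tendsto_toReal ENNReal.zero_ne_top).comp h
    exact h'.eventually (gt_mem_nhds (by simpa using hη))
  have h1 := hlim (fun δ => Ioo m (m + δ)) (fun _ => measurableSet_Ioo)
    (fun a b hab => Ioo_subset_Ioo_right (by linarith)) fun x => by
      rcases le_or_gt x m with h | h
      · exact ⟨1, one_pos, fun hx => absurd hx.1 h.not_gt⟩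
      · exact ⟨x - m, sub_pos.2 h, fun hx => by linarith [hx.2]⟩
  have h2 := hlim (fun δ => Ioo (m - δ) m) (fun _ => measurableSet_Ioo)
    (fun a b hab => Ioo_subset_Ioo_left (by linarith)) fun x => by
      rcases le_or_gt m x with h | h
      · exact ⟨1, one_pos, fun hx => absurd hx.2 h.not_gt⟩
      · exact ⟨m - x, sub_pos.2 h, fun hx => by linarith [hx.1]⟩
  obtain ⟨δ, ⟨hδ1, hδ2⟩, hδ0⟩ := ((h1.and h2).and self_mem_nhdsWithin).exists
  exact ⟨δ, hδ0, hδ1, hδ2⟩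

/-- The relative error of the linearization of the sample expectile vanishes almost surely. -/
lemma tendsto_relative_error [IsProbabilityMeasure ν] (hindep : iIndepFun Ys P)
    (hlaw : ∀ k, HasLaw (Ys k) ν P) (hν : Integrable id ν) (hτ : τ ∈ Ioo (0 : ℝ) 1) {m : ℝ}
    (hm : meanIdent τ ν m = 0) :
    ∀ᵐ ω ∂P, Tendsto (fun n : ℕ =>
      ((sampleExpectile τ n fun k => Ys k ω) - m - twoSlope (sigmaOne τ ν m) (sigmaTwo τ ν m)
        (meanIdent τ (empiricalMeasure n fun k => Ys k ω) m))
        / meanIdent τ (empiricalMeasure n fun k => Ys k ω) m) atTop (𝓝 0) := by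
  have hc : 0 < min τ (1 - τ) := lt_min hτ.1 (by linarith [hτ.2])
  have hc1 := min_le_left τ (1 - τ)
  have hc2 := min_le_right τ (1 - τ)
  set c := min τ (1 - τ)
  -- The slope error and the interval mass get `ε * c ^ 2 / 4` each; dividing their sum by `c ^ 2`
  -- leaves a relative error of `ε / 2`. Only countably many `ε` are used, to keep one null set.
  have hη (ε : ℝ) (hε : 0 < ε) : 0 < ε * c ^ 2 / 4 := by positivity
  have hex (j : ℕ) := exists_real_Ioo_lt ν m (hη (1 / ((j : ℝ) + 1)) (by positivity))
  choose δ hδ0 hδr hδl using hex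
  have hreal {s : Set ℝ} (hs : MeasurableSet s) := tendsto_real_empiricalMeasure hindep hlaw hs
  have hr : ∀ᵐ ω ∂P, ∀ j : ℕ, _ := ae_all_iff.2 fun j : ℕ =>
    hreal (measurableSet_Ioo (a := m) (b := m + δ j))
  have hl : ∀ᵐ ω ∂P, ∀ j : ℕ, _ := ae_all_iff.2 fun j : ℕ =>
    hreal (measurableSet_Ioo (a := m - δ j) (b := m))
  filter_upwards [hr, hl, hreal (measurableSet_Iic (a := m)), hreal (measurableSet_Iio (a := m)),
    tendsto_sampleExpectile hindep hlaw hν hτ hm] with ω hrω hlω hA hB hT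
  have hA' : Tendsto (fun n : ℕ => |rightSlope τ (empiricalMeasure n fun k => Ys k ω) m
      - rightSlope τ ν m|) atTop (𝓝 0) := by
    have : Tendsto (fun n : ℕ => rightSlope τ (empiricalMeasure n fun k => Ys k ω) m) atTop
        (𝓝 (rightSlope τ ν m)) := ((hA.const_sub 1).const_mul τ).add (hA.const_mul (1 - τ))
    simpa using (this.sub_const (rightSlope τ ν m)).abs
  have hB' : Tendsto (fun n : ℕ => |leftSlope τ (empiricalMeasure n fun k => Ys k ω) m
      - leftSlope τ ν m|) atTop (𝓝 0) := by
    have : Tendsto (fun n : ℕ => leftSlope τ (empiricalMeasure n fun k => Ys k ω) m) atTop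
        (𝓝 (leftSlope τ ν m)) := ((hB.const_sub 1).const_mul τ).add (hB.const_mul (1 - τ))
    simpa using (this.sub_const (leftSlope τ ν m)).abs
  refine Metric.tendsto_nhds.2 fun ε hε => ?_
  obtain ⟨j, hj⟩ := exists_nat_one_div_lt hε
  have hj0 : (0 : ℝ) < 1 / ((j : ℝ) + 1) := by positivity
  have hηj := hη _ hj0
  have hδrj := hδr j
  have hδlj := hδl j
  set ε' := 1 / ((j : ℝ) + 1)
  filter_upwards [(hrω j).eventually (gt_mem_nhds hδrj),
    (hlω j).eventually (gt_mem_nhds hδlj), hA'.eventually (gt_mem_nhds hηj),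
    hB'.eventually (gt_mem_nhds hηj), Metric.tendsto_nhds.1 hT (δ j) (hδ0 j),
    eventually_ge_atTop 1] with n hn1 hn2 hn3 hn4 hn5 hn
  have := isProbabilityMeasure_empiricalMeasure hn fun k => Ys k ω
  have hi := integrable_empiricalMeasure hn (fun k => Ys k ω) id
  have hz : meanIdent τ (empiricalMeasure n fun k => Ys k ω)
    (sampleExpectile τ n fun k => Ys k ω) = 0 := meanIdent_expectile hi hτ
  set x := sampleExpectile τ n fun k => Ys k ω
  set νn := empiricalMeasure n fun k => Ys k ω
  rw [Real.dist_eq, abs_lt] at hn5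
  have s1 : νn.real (Ioo m x) ≤ νn.real (Ioo m (m + δ j)) :=
    measureReal_mono (Ioo_subset_Ioo_right (by linarith))
  have s2 : νn.real (Ioo x m) ≤ νn.real (Ioo (m - δ j) m) :=
    measureReal_mono (Ioo_subset_Ioo_left (by linarith))
  have key := abs_sub_twoSlope_le hi hτ hc hc1 hc2 (m := m)
    (η := ε' * c ^ 2 / 2)
    (le_rightSlope (ν := ν) hc1 hc2 m) (le_leftSlope (ν := ν) hc1 hc2 m) hz
    (by linarith) (by linarith)
  rw [← sigmaOne_eq, ← sigmaTwo_eq] at key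
  rw [Real.dist_eq, sub_zero, abs_div]
  have e : ε' * c ^ 2 / 2 / c ^ 2 = ε' / 2 := by field_simp
  rw [e] at key
  calc _ ≤ ε' / 2 := div_le_of_le_mul₀ (abs_nonneg _) (by positivity) key
    _ < ε := by linarith

end StrongLaw

/-! ### Asymmetric rescalings of a normal law -/

lemma gaussianReal_Ioi_injective (a : ℝ) {v : ℝ≥0} (hv : v ≠ 0) :
    Function.Injective fun x => gaussianReal a v (Ioi x) := by
  refine (StrictAnti.injective fun x y hxy => ?_)
  have hpos : gaussianReal a v (Ioc x y) ≠ 0 := fun h => by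
    have := gaussianReal_absolutelyContinuous' a hv h
    simp [hxy.not_ge] at this
  have hunion : gaussianReal a v (Ioi x)
      = gaussianReal a v (Ioc x y) + gaussianReal a v (Ioi y) := by
    rw [← Ioc_union_Ioi_eq_Ioi hxy.le, measure_union (Ioc_disjoint_Ioi le_rfl) measurableSet_Ioi]
  change gaussianReal a v (Ioi y) < gaussianReal a v (Ioi x)
  rw [hunion, add_comm]
  exact ENNReal.lt_add_right (measure_ne_top _ _) hpos

lemma gaussianReal_Iio (a : ℝ) (v : ℝ≥0) (x : ℝ) :
    gaussianReal a v (Iio x) = gaussianReal a v (Ioi (2 * a - x)) := by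
  have h := gaussianReal_map_const_sub (μ := a) (v := v) (2 * a)
  rw [show 2 * a - a = a by ring] at h
  conv_rhs => rw [← h, Measure.map_apply (by fun_prop) measurableSet_Ioi]
  congr 1
  ext z
  simp

lemma lt_twoSlope_iff {a b t w : ℝ} (ha : 0 < a) (hb : 0 < b) (ht : 0 ≤ t) :
    t < twoSlope a b w ↔ t / a < w := by
  rw [div_lt_iff₀ ha]
  rcases le_total 0 w with h | h
  · rw [twoSlope_of_nonneg h, mul_comm]
  · rw [twoSlope_of_nonpos h]
    constructor <;> intro h' <;> nlinarith

lemma twoSlope_lt_iff {a b t w : ℝ} (ha : 0 < a) (hb : 0 < b) (ht : t ≤ 0) :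
    twoSlope a b w < t ↔ w < t / b := by
  rw [lt_div_iff₀ hb]
  rcases le_total 0 w with h | h
  · rw [twoSlope_of_nonneg h]
    constructor <;> intro h' <;> nlinarith
  · rw [twoSlope_of_nonpos h, mul_comm]

/-- Stretching the two halves of a centred normal law by different factors destroys normality:
the median stays at `0`, so the image would have to be symmetric about `0`, but its two tails
differ. -/
lemma map_twoSlope_gaussianReal_ne {a b : ℝ} (ha : 0 < a) (hb : 0 < b) (hab : a ≠ b) {s : ℝ≥0}
    (hs : s ≠ 0) (μ : ℝ) (v : ℝ≥0) :
    (gaussianReal 0 s).map (twoSlope a b) ≠ gaussianReal μ v := by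
  intro heq
  have hmeas : Measurable (twoSlope a b) := (continuous_twoSlope a b).measurable
  have hI {t : ℝ} (ht : 0 ≤ t) : gaussianReal μ v (Ioi t) = gaussianReal 0 s (Ioi (t / a)) := by
    rw [← heq, Measure.map_apply hmeas measurableSet_Ioi]
    congr 1
    ext w
    exact lt_twoSlope_iff ha hb ht
  have hJ {t : ℝ} (ht : t ≤ 0) :
      gaussianReal μ v (Iio t) = gaussianReal 0 s (Ioi (-t / b)) := by
    rw [← heq, Measure.map_apply hmeas measurableSet_Iio,
      show -t / b = 2 * 0 - t / b by ring, ← gaussianReal_Iio]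
    congr 1
    ext w
    exact twoSlope_lt_iff ha hb ht
  have h0 : gaussianReal μ v (Ioi 0) = gaussianReal μ v (Ioi (2 * μ)) := by
    rw [hI le_rfl, ← sub_zero (2 * μ), ← gaussianReal_Iio, hJ le_rfl]
    simp
  have hinj := gaussianReal_Ioi_injective 0 hs
  -- The image has positive mass on `(0, ∞)` and on `(-∞, 0)`, so it is not a point mass.
  have hv : v ≠ 0 := by
    rintro rfl
    rw [gaussianReal_zero_var] at *
    have hp : gaussianReal 0 s (Ioi 0) ≠ 0 := fun h => by
      have h1 : gaussianReal 0 s (Ioi 1) = 0 :=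
        measure_mono_null (Ioi_subset_Ioi zero_le_one) h
      exact zero_ne_one (hinj (h.trans h1.symm))
    have p1 := hI (t := 0) le_rfl
    have p2 := hJ (t := 0) le_rfl
    simp only [zero_div, neg_zero] at p1 p2
    rw [← p1] at hp p2
    rw [Measure.dirac_apply' _ measurableSet_Ioi] at hp p2
    rw [Measure.dirac_apply' _ measurableSet_Iio] at p2
    have q1 : (0 : ℝ) < μ := by by_contra hq; simp [hq] at hp
    simp [q1, q1.not_gt] at p2
  have hμ : μ = 0 := by
    have := gaussianReal_Ioi_injective μ hv h0
    linarith
  subst hμ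
  have h1 : gaussianReal 0 s (Ioi (1 / a)) = gaussianReal 0 s (Ioi (1 / b)) := by
    rw [← hI zero_le_one]
    have := gaussianReal_Iio 0 v (-1)
    rw [hJ (by norm_num)] at this
    simpa using this.symm
  have := hinj h1
  rw [one_div, one_div, inv_inj] at this
  exact hab this

end Expectile

namespace Expectile

/-! ### The limit theorem -/

section Limit

variable {τ : ℝ} {Ω : Type*} [MeasurableSpace Ω] {P : Measure Ω} [IsProbabilityMeasure P]
  {Ys : ℕ → Ω → ℝ} {ν : Measure ℝ} [IsProbabilityMeasure ν]
  {Ω' : Type*} [MeasurableSpace Ω'] {P' : Measure Ω'} [IsProbabilityMeasure P'] {W : Ω' → ℝ}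

lemma memLp_ident (hν : MemLp id 2 ν) (τ x : ℝ) : MemLp (ident τ x) 2 ν := by
  refine ((hν.sub (memLp_const x)).const_mul (|τ| + |1 - τ|)).mono
    (measurable_ident τ x).aestronglyMeasurable (ae_of_all _ fun y => ?_)
  simp only [Real.norm_eq_abs, Pi.sub_apply, id, abs_mul]
  have hs := abs_of_nonneg (add_nonneg (abs_nonneg τ) (abs_nonneg (1 - τ)))
  rcases le_total x y with h | h
  · rw [ident_of_le h, abs_mul, hs]
    gcongr
    linarith [abs_nonneg (1 - τ)]
  · rw [ident_of_ge h, abs_mul, hs]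
    gcongr
    linarith [abs_nonneg τ]

/-- The central limit theorem for the identification function at the expectile. -/
lemma tendstoInDistribution_sqrt_mul_meanIdent (hindep : iIndepFun Ys P)
    (hlaw : ∀ k, HasLaw (Ys k) ν P) (hν : MemLp id 2 ν) {m : ℝ} (hm : meanIdent τ ν m = 0)
    (hW : HasLaw W (gaussianReal 0 (∫ y, ident τ m y ^ 2 ∂ν).toNNReal) P') :
    TendstoInDistribution
      (fun (n : ℕ) ω => √(n : ℝ) * meanIdent τ (empiricalMeasure n fun k => Ys k ω) m)
      atTop W (fun _ => P) P' := by
  have h0 : ∀ k, AEMeasurable (Ys k) P := fun k => (hlaw k).aemeasurable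
  have hI := measurable_ident τ m
  have hL : MemLp (fun ω => ident τ m (Ys 0 ω)) 2 P := by
    have := memLp_ident hν τ m
    rw [← (hlaw 0).map_eq] at this
    exact this.comp_of_map (h0 0)
  have hmean : ∫ ω, ident τ m (Ys 0 ω) ∂P = 0 := by
    rw [← integral_map (h0 0) hI.aestronglyMeasurable, (hlaw 0).map_eq]
    exact hm
  have hvar : variance (fun ω => ident τ m (Ys 0 ω)) P = ∫ y, ident τ m y ^ 2 ∂ν := by
    rw [variance_of_integral_eq_zero hL.aemeasurable hmean, ← (hlaw 0).map_eq,
      integral_map (h0 0) (hI.pow_const 2).aestronglyMeasurable]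
  have hclt := tendstoInDistribution_inv_sqrt_mul_sum_sub (X := fun k ω => ident τ m (Ys k ω))
    (P := P) (Y := W) (P' := P') (by rwa [hvar]) hL (hindep.comp (fun _ => ident τ m) fun _ => hI)
    fun k => IdentDistrib.comp ⟨h0 k, h0 0, by rw [(hlaw k).map_eq, (hlaw 0).map_eq]⟩ hI
  refine hclt.congr (fun n => ae_of_all _ fun ω => ?_) (ae_of_all _ fun _ => rfl)
  simp only [hmean, mul_zero, sub_zero]
  rw [meanIdent, integral_empiricalMeasure, ← mul_assoc]
  congr 1
  rw [← div_eq_mul_inv, Real.sqrt_div_self', one_div]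

lemma tendstoInDistribution_sampleExpectile (hindep : iIndepFun Ys P)
    (hlaw : ∀ k, HasLaw (Ys k) ν P) (hν : MemLp id 2 ν) (hτ : τ ∈ Ioo (0 : ℝ) 1) {m : ℝ}
    (hm : meanIdent τ ν m = 0)
    (hW : HasLaw W (gaussianReal 0 (∫ y, ident τ m y ^ 2 ∂ν).toNNReal) P') :
    TendstoInDistribution
      (fun (n : ℕ) ω => √(n : ℝ) * ((sampleExpectile τ n fun k => Ys k ω) - m))
      atTop (fun ω' => twoSlope (sigmaOne τ ν m) (sigmaTwo τ ν m) (W ω')) (fun _ => P) P' := by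
  have hνi : Integrable id ν := hν.integrable one_le_two
  have hclt := tendstoInDistribution_sqrt_mul_meanIdent hindep hlaw hν hm hW
  set L : ℕ → (ℕ → ℝ) → ℝ := fun n y => meanIdent τ (empiricalMeasure n y) m with hLdef
  set R : ℕ → (ℕ → ℝ) → ℝ := fun n y =>
    (sampleExpectile τ n y - m - twoSlope (sigmaOne τ ν m) (sigmaTwo τ ν m) (L n y)) / L n y
    with hRdef
  have hYs : AEMeasurable (fun ω k => Ys k ω) P :=
    aemeasurable_pi_lambda _ fun k => (hlaw k).aemeasurable
  have hLm (n : ℕ) : Measurable (L n) := measurable_meanIdent_empiricalMeasure τ n m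
  have hRm (n : ℕ) : AEMeasurable (fun ω => R n fun k => Ys k ω) P := by
    have : Measurable (R n) := (((measurable_sampleExpectile hτ n).sub_const m).sub
      ((continuous_twoSlope _ _).measurable.comp (hLm n))).div (hLm n)
    exact this.comp_aemeasurable hYs
  have hR0 : TendstoInMeasure P (fun n ω => R n fun k => Ys k ω) atTop fun _ => 0 :=
    tendstoInMeasure_of_tendsto_ae (fun n => (hRm n).aestronglyMeasurable)
      (tendsto_relative_error hindep hlaw hνi hτ hm)
  have hslutsky := hclt.continuous_comp_prodMk_of_tendstoInMeasure_const
    (g := fun p : ℝ × ℝ => twoSlope (sigmaOne τ ν m) (sigmaTwo τ ν m) p.1 + p.2 * p.1)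
    (by fun_prop) hR0 hRm
  refine hslutsky.congr (fun n => ae_of_all _ fun ω => ?_) (ae_of_all _ fun ω' => by simp)
  rcases Nat.eq_zero_or_pos n with rfl | hn
  · simp [twoSlope]
  have := isProbabilityMeasure_empiricalMeasure hn fun k => Ys k ω
  have hi := integrable_empiricalMeasure hn (fun k => Ys k ω) id
  change twoSlope _ _ (√(n : ℝ) * L n fun k => Ys k ω)
    + (R n fun k => Ys k ω) * (√(n : ℝ) * L n fun k => Ys k ω) = _
  rw [twoSlope_mul_left (Real.sqrt_nonneg _)]
  by_cases h : (L n fun k => Ys k ω) = 0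
  · -- `R` divides by zero here, but then `m` is the sample expectile and both sides vanish.
    have hz : sampleExpectile τ n (fun k => Ys k ω) = m :=
      (strictAnti_meanIdent hi hτ).injective ((meanIdent_expectile hi hτ).trans h.symm)
    simp [hz, h, twoSlope]
  · simp only [hRdef]
    field_simp
    ring

end Limit

/-! ### Atoms at the expectile -/

lemma sigmaOne_ne_sigmaTwo {τ : ℝ} {ν : Measure ℝ} [IsProbabilityMeasure ν] {m : ℝ}
    (hm : 0 < ν {m}) (hτ : τ ≠ 1 / 2) : sigmaOne τ ν m ≠ sigmaTwo τ ν m := by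
  have hu : ν.real (Iic m) = ν.real (Iio m) + ν.real {m} := by
    rw [← Iio_union_right, measureReal_union (by simp) (measurableSet_singleton m)]
  have hp : 0 < ν.real {m} := ENNReal.toReal_pos hm.ne' (measure_ne_top _ _)
  rw [sigmaOne_eq, sigmaTwo_eq, one_div, one_div, Ne, inv_inj, rightSlope, leftSlope, hu]
  intro h
  have : (1 - 2 * τ) * ν.real {m} = 0 := by linarith
  rcases mul_eq_zero.1 this with h | h
  · exact hτ (by linarith)
  · exact hp.ne' h

lemma integral_ident_sq_pos {τ : ℝ} (hτ : τ ∈ Ioo (0 : ℝ) 1) {Ω : Type*} [MeasurableSpace Ω]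
    {P : Measure Ω} [IsProbabilityMeasure P] {Y : Ω → ℝ} {m : ℝ}
    (hI : MemLp (fun ω => ident τ m (Y ω)) 2 P) (hY : 0 < variance Y P) :
    0 < ∫ ω, ident τ m (Y ω) ^ 2 ∂P := by
  refine lt_of_le_of_ne (integral_nonneg fun ω => sq_nonneg _) fun h => hY.ne' ?_
  have h0 := (integral_eq_zero_iff_of_nonneg (fun ω => sq_nonneg _) hI.integrable_sq).1 h.symm
  have hYm : Y =ᵐ[P] fun _ => m := by
    filter_upwards [h0] with ω hω
    have hz : ident τ m (Y ω) = 0 := pow_eq_zero_iff two_ne_zero |>.1 hω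
    rcases le_total m (Y ω) with h | h
    · rw [ident_of_le h] at hz
      exact sub_eq_zero.1 ((mul_eq_zero.1 hz).resolve_left hτ.1.ne')
    · rw [ident_of_ge h] at hz
      exact sub_eq_zero.1 ((mul_eq_zero.1 hz).resolve_left (by linarith [hτ.2]))
  rw [variance_congr hYm, variance_eq_integral aemeasurable_const]
  simp

end Expectile

theorem mainTheorem1
    {Ω : Type*} [MeasurableSpace Ω] (P : Measure Ω) [IsProbabilityMeasure P]
    (Y : Ω → ℝ) (Ys : ℕ → Ω → ℝ)
    (hindep : iIndepFun Ys P) (hident : ∀ k, IdentDistrib (Ys k) Y P P)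
    (hY : MemLp Y 2 P)
    (τ : ℝ) (hτ : τ ∈ Ioo (0 : ℝ) 1)
    (ν : Measure ℝ) (hν : ν = P.map Y)
    (m : ℝ) (hm : m = Expectile.expectile τ ν)
    {Ω' : Type*} [MeasurableSpace Ω'] (P' : Measure Ω') [IsProbabilityMeasure P']
    (W : Ω' → ℝ)
    (hW : HasLaw W (gaussianReal 0 (∫ ω, Expectile.ident τ m (Y ω) ^ 2 ∂P).toNNReal) P') :
    -- the expectiles of `Y` and of the samples are well defined
    (∃! x, Expectile.IsExpectile τ ν x) ∧
    (∀ n : ℕ, 1 ≤ n → ∀ y : ℕ → ℝ,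
      ∃! x, Expectile.IsExpectile τ (Expectile.empiricalMeasure n y) x) ∧
    -- convergence in law of the centred and scaled sample expectiles
    TendstoInDistribution
      (fun (n : ℕ) (ω : Ω) =>
        √(n : ℝ) * (Expectile.sampleExpectile τ n (fun k => Ys k ω) - m))
      atTop
      (fun ω' => Expectile.twoSlope (Expectile.sigmaOne τ ν m) (Expectile.sigmaTwo τ ν m) (W ω'))
      (fun _ => P) P' ∧
    -- the limit is not normal, not even degenerate, if `Y` is not a.s. constant,
    -- its law has an atom at its expectile and `τ ≠ 1/2`
    (0 < variance Y P → 0 < P {ω | Y ω = m} → τ ≠ 1 / 2 →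
      ∀ (a : ℝ) (v : ℝ≥0),
        P'.map (fun ω' =>
          Expectile.twoSlope (Expectile.sigmaOne τ ν m) (Expectile.sigmaTwo τ ν m) (W ω'))
          ≠ gaussianReal a v) := by
  have hYm : AEMeasurable Y P := hY.aemeasurable
  have : IsProbabilityMeasure ν := hν ▸ Measure.isProbabilityMeasure_map hYm
  have hYlaw : HasLaw Y ν P := ⟨hYm, hν.symm⟩
  have hlaw (k : ℕ) : HasLaw (Ys k) ν P :=
    ⟨(hident k).aemeasurable_fst, by rw [(hident k).map_eq, hν]⟩
  have hL2 : MemLp id 2 ν := by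
    rw [hν]
    exact (memLp_map_measure_iff aestronglyMeasurable_id hYm).2 hY
  have hνi : Integrable id ν := hL2.integrable one_le_two
  have hm0 : Expectile.meanIdent τ ν m = 0 := hm ▸ Expectile.meanIdent_expectile hνi hτ
  have hsq : ∫ ω, Expectile.ident τ m (Y ω) ^ 2 ∂P = ∫ y, Expectile.ident τ m y ^ 2 ∂ν := by
    rw [hν, integral_map hYm
      ((Expectile.measurable_ident τ m).pow_const 2).aestronglyMeasurable]
  refine ⟨Expectile.existsUnique_isExpectile hνi hτ, fun n hn y => ?_,
    Expectile.tendstoInDistribution_sampleExpectile hindep hlaw hL2 hτ hm0 (hsq ▸ hW),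
    fun hvar hatom hne a v => ?_⟩
  · have := Expectile.isProbabilityMeasure_empiricalMeasure hn y
    exact Expectile.existsUnique_isExpectile (Expectile.integrable_empiricalMeasure hn y id) hτ
  · have hI : MemLp (fun ω => Expectile.ident τ m (Y ω)) 2 P := by
      have := Expectile.memLp_ident hL2 τ m
      rw [hν] at this
      exact this.comp_of_map hYm
    have hpos := Expectile.integral_ident_sq_pos hτ hI hvar
    have hmass : 0 < ν {m} := by
      rw [hν, Measure.map_apply_of_aemeasurable hYm (measurableSet_singleton m)]
      exact hatom
    have hc : 0 < min τ (1 - τ) := lt_min hτ.1 (by linarith [hτ.2])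
    have hmap := AEMeasurable.map_map_of_aemeasurable (μ := P') (f := W)
      (g := Expectile.twoSlope (Expectile.sigmaOne τ ν m) (Expectile.sigmaTwo τ ν m))
      (Expectile.continuous_twoSlope _ _).measurable.aemeasurable hW.aemeasurable
    rw [hW.map_eq] at hmap
    change P'.map (Expectile.twoSlope _ _ ∘ W) ≠ _
    rw [← hmap]
    refine Expectile.map_twoSlope_gaussianReal_ne ?_ ?_
      (Expectile.sigmaOne_ne_sigmaTwo hmass hne) (Real.toNNReal_pos.2 hpos).ne' a v
    · rw [Expectile.sigmaOne_eq]
      exact one_div_pos.2 (hc.trans_le (Expectile.le_rightSlope (min_le_left _ _)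
        (min_le_right _ _) m))
    · rw [Expectile.sigmaTwo_eq]
      exact one_div_pos.2 (hc.trans_le (Expectile.le_leftSlope (min_le_left _ _)
        (min_le_right _ _) m))
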